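/- Let $G$ be a finite group, let $X$ and $X'$ be $G$-modules (that is, $\mathbb Z[G]$-modules), and let $r,s\in\mathbb Z$. For $G$-modules $M$ and $N$, let $G$ act on $\operatorname{Hom}_{\mathbb Z}(M,N)$ by conjugation, $(gf)(m)=g\,f(g^{-1}m)$, and let $\widehat H^n(G,-)$, $n\in\mathbb Z$, denote Tate cohomology. For a $G$-module $A$, $a\in\widehat H^s(G,\operatorname{Hom}_{\mathbb Z}(X,A))$ and $x\in\widehat H^r(G,\operatorname{Hom}_{\mathbb Z}(X',X))$, let $a\cup x\in\widehat H^{r+s}(G,\operatorname{Hom}_{\mathbb Z}(X',A))$ denote the image of $(a,x)$ under the cup product followed by the map induced by composition, $$\widehat H^s(G,\operatorname{Hom}_{\mathbb Z}(X,A))\times\widehat H^r(G,\operatorname{Hom}_{\mathbb Z}(X',X))\xrightarrow{\ \cup\ }\widehat H^{r+s}(G,\operatorname{Hom}_{\mathbb Z}(X,A)\otimes_{\mathbb Z}\operatorname{Hom}_{\mathbb Z}(X',X))\longrightarrow\widehat H^{r+s}(G,\operatorname{Hom}_{\mathbb Z}(X',A)),\qquad f\otimes\varphi\mapsto f\circ\varphi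 .$$ Then for every natural transformation $$\Phi_\bullet\colon\widehat H^s(G,\operatorname{Hom}_{\mathbb Z}(X,-))\Rightarrow\widehat H^{r+s}(G,\operatorname{Hom}_{\mathbb Z}(X',-))$$ of functors from $G$-modules to abelian groups there is a unique class $x\in\widehat H^r(G,\operatorname{Hom}_{\mathbb Z}(X',X))$ such that $\Phi_\bullet=(-\cup x)$, that is, $\Phi_A(a)=a\cup x$ for every $G$-module $A$ and every $a\in\widehat H^s(G,\operatorname{Hom}_{\mathbb Z}(X,A))$. -/

import Mathlib

/-
Cup products in the Tate cohomology of a finite group `G` (Mathlib's `tateCohomology`), built by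
dimension shifting. A `G`-module is an object of `Rep ℤ G`; the construction works over any
commutative ring `k` in place of `ℤ`.
-/
open CategoryTheory

noncomputable section

namespace TateCup

open MonoidalCategory

set_option linter.unusedSectionVars false

universe u
variable {k G : Type u} [CommRing k] [Group G] [Fintype G]

/-- A chain map which is null-homotopic around degree `j` induces zero on homology in degree `j`. -/
theorem homologyMap_eq_zero {K L : CochainComplex (ModuleCat k) ℤ} (φ : K ⟶ L) (i j l : ℤ)
    (s : K.X j ⟶ L.X i) (s' : K.X l ⟶ L.X j) (h : φ.f j = s ≫ L.d i j + K.d j l ≫ s') :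
    HomologicalComplex.homologyMap φ j = 0 := by
  have h1 : HomologicalComplex.cyclesMap φ j = (K.iCycles j ≫ s) ≫ L.toCycles i j := by
    rw [← cancel_mono (L.iCycles j)]
    simp [h]
  rw [← cancel_epi (K.homologyπ j), HomologicalComplex.homologyπ_naturality, h1]
  simp

/-- The contraction `f ↦ ∑ g, g⁻¹ h (f (g, -))` on inhomogeneous cochains. -/
def sPos {M N : Rep.{u} k G} (h : M →ₗ[k] N) (n : ℕ) :
    ((Fin (n + 1) → G) → M) →ₗ[k] ((Fin n → G) → N) where
  toFun f t := ∑ g : G, N.ρ g⁻¹ (h (f (Fin.cons g t)))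
  map_add' f f' := by ext t; simp [Finset.sum_add_distrib]
  map_smul' c f := by ext t; simp [Finset.smul_sum]

/-- The contraction `a·[t] ↦ ∑ g, h(g a)·[g, t]` on inhomogeneous chains. -/
def sNeg {M N : Rep.{u} k G} (h : M →ₗ[k] N) (n : ℕ) :
    ((Fin n → G) →₀ M) →ₗ[k] ((Fin (n + 1) → G) →₀ N) :=
  Finsupp.lsum k fun t => ∑ g : G, Finsupp.lsingle (Fin.cons g t : Fin (n + 1) → G) ∘ₗ h ∘ₗ M.ρ g

theorem contract_cons_zero (n : ℕ) (g : G) (t : Fin (n + 1) → G) :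
    Fin.contractNth 0 (· * ·) (Fin.cons g t : Fin (n + 2) → G) =
      Fin.cons (g * t 0) fun i => t i.succ := by
  ext i
  refine Fin.cases ?_ (fun i => ?_) i
  · simp [Fin.contractNth]
  · simp [Fin.contractNth]

theorem contract_cons_succ (n : ℕ) (g : G) (t : Fin (n + 1) → G) (j : Fin (n + 1)) :
    Fin.contractNth j.succ (· * ·) (Fin.cons g t : Fin (n + 2) → G) =
      Fin.cons g (Fin.contractNth j (· * ·) t) := by
  ext i
  refine Fin.cases ?_ (fun i => ?_) i
  · simp [Fin.contractNth]
  · simp [Fin.contractNth]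

/-- The homotopy identity on cochains of positive degree. -/
theorem cyl_pos {M N : Rep.{u} k G} (h : M →ₗ[k] N) (n : ℕ) (f : (Fin (n+1) → G) → M)
    (t : Fin (n+1) → G) :
    ∑ g : G, N.ρ g (h (M.ρ g⁻¹ (f t))) =
      (inhomogeneousCochains.d N n).hom (sPos h n f) t +
        sPos h (n+1) ((inhomogeneousCochains.d M (n+1)).hom f) t := by
  simp only [inhomogeneousCochains.d_hom_apply, sPos, LinearMap.coe_mk, AddHom.coe_mk]
  rw [← Equiv.sum_comp (Equiv.inv G)]
  simp only [Equiv.inv_apply, inv_inv, Fin.cons_zero, Fin.cons_succ]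
  simp only [Fin.sum_univ_succ (n := n + 1), contract_cons_zero, contract_cons_succ, map_add,
    map_sum, map_smul, Finset.sum_add_distrib, Fin.val_zero, Fin.val_succ]
  rw [← Equiv.sum_comp (Equiv.mulRight (t 0)) (fun x => N.ρ (t 0) _)]
  rw [Finset.sum_comm (s := (Finset.univ : Finset G))]
  simp only [Equiv.coe_mulRight, mul_inv_rev, map_mul, Module.End.mul_apply,
    Representation.self_inv_apply, pow_succ, pow_zero, mul_neg, mul_one, neg_smul, one_smul, neg_neg,
    Finset.sum_neg_distrib, Finset.smul_sum]
  abel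

/-- The differential of inhomogeneous chains, as a linear map. -/
def dNeg (N : Rep.{u} k G) (n : ℕ) : ((Fin (n + 1) → G) →₀ N) →ₗ[k] ((Fin n → G) →₀ N) :=
  (groupHomology.inhomogeneousChains.d N n).hom

theorem d_single' (N : Rep.{u} k G) (n : ℕ) (g : Fin (n + 1) → G) (a : N) :
    dNeg N n (Finsupp.single g a) =
      Finsupp.single (fun i => g i.succ) (N.ρ (g 0)⁻¹ a) +
        ∑ j : Fin (n + 1),
          (-1 : k) ^ ((j : ℕ) + 1) • Finsupp.single (Fin.contractNth j (· * ·) g) a :=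
  groupHomology.inhomogeneousChains.d_single n g a

/-- The homotopy identity on chains of positive degree. -/
theorem cyl_neg {M N : Rep.{u} k G} (h : M →ₗ[k] N) (n : ℕ) (t : Fin (n+1) → G) (m : M) :
    Finsupp.single t (∑ g : G, N.ρ g (h (M.ρ g⁻¹ m))) =
      dNeg N (n + 1) (sNeg h (n + 1) (Finsupp.single t m)) +
        sNeg h n (dNeg M n (Finsupp.single t m)) := by
  rw [← Equiv.sum_comp (Equiv.inv G)]
  simp only [sNeg, Finsupp.lsum_single, LinearMap.sum_apply, LinearMap.comp_apply,
    Finsupp.lsingle_apply, map_sum, d_single', map_add, map_smul]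
  simp only [Fin.sum_univ_succ (n := n + 1), contract_cons_zero, contract_cons_succ,
    Finset.sum_add_distrib, Fin.val_zero, Fin.val_succ, Fin.cons_zero, Fin.cons_succ]
  rw [← Equiv.sum_comp (Equiv.mulRight (t 0))
    (fun x => Finsupp.single _ (h (M.ρ x (M.ρ (t 0)⁻¹ m))))]
  rw [Finset.sum_comm (s := (Finset.univ : Finset G))]
  simp only [Equiv.coe_mulRight, map_mul, Module.End.mul_apply, Equiv.inv_apply, inv_inv,
    Representation.self_inv_apply, pow_succ, pow_zero, mul_neg, mul_one, neg_smul, one_smul, neg_neg,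
    Finset.sum_neg_distrib, Finset.smul_sum]
  abel_nf
  exact Finsupp.single_finsetSum _ _ _

/-- A morphism of `G`-modules that is the norm `∑ g, g h g⁻¹` of a linear map `h` induces zero on
Tate cohomology in every degree. -/
theorem tateMap_eq_zero {M N : Rep.{u} k G} (h : M →ₗ[k] N) (f : M ⟶ N)
    (hf : ∀ m, f.hom m = ∑ g : G, N.ρ g (h (M.ρ g⁻¹ m))) (n : ℤ) :
    (tateCohomologyFunctor n).map f = 0 := by
  change HomologicalComplex.homologyMap (tateComplex.map f) n = 0
  let e : ((Fin 0 → G) → M) →ₗ[k] ((Fin 0 → G) →₀ N) :=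
    Finsupp.lsingle default ∘ₗ h ∘ₗ LinearMap.proj default
  obtain (n | n) := n
  · obtain _ | n := n
    · refine homologyMap_eq_zero _ (.negSucc 0) 0 1 (ModuleCat.ofHom e) (ModuleCat.ofHom (sPos h 0)) ?_
      refine ModuleCat.hom_ext (LinearMap.ext fun x => funext fun t => ?_)
      change f.hom (x t) = (N.tateNorm).hom (e x) t +
        sPos h 0 (((groupCohomology.inhomogeneousCochains M).d 0 1).hom x) t
      rw [groupCohomology.inhomogeneousCochains.d_def, Rep.tateNorm_eq, hf]
      have hx : ∀ t' : Fin 0 → G, x t' = x t := fun t' => congrArg x (Subsingleton.elim _ _)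
      have h1 : (ModuleCat.ofHom (Finsupp.lsum k fun _ : Fin 0 → G =>
          LinearMap.pi fun _ : Fin 0 → G => N.ρ.norm)).hom (e x) t = N.ρ.norm (h (x t)) := by
        have h2 : e x = Finsupp.single default (h (x t)) := by
          rw [← hx default]; rfl
        rw [h2]
        exact congrFun (Finsupp.lsum_single k
          (fun _ : Fin 0 → G => LinearMap.pi fun _ : Fin 0 → G => N.ρ.norm) default (h (x t))) t
      have hd : ∀ s, (inhomogeneousCochains.d M 0).hom x s = M.ρ (s 0) (x t) - x t := fun s => by
        refine (inhomogeneousCochains.d_hom_apply M 0 x s).trans ?_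
        simp [hx, sub_eq_add_neg]
      refine Eq.trans ?_ (congrArg (· + _) h1.symm)
      rw [← Equiv.sum_comp (Equiv.inv G)]
      simp [sPos, hd, Representation.norm, Finset.sum_sub_distrib,
        ← Equiv.sum_comp (Equiv.inv G) (fun g => N.ρ g (h (x t)))]
    · refine homologyMap_eq_zero _ (n : ℤ) (n + 1 : ℕ) (n + 2 : ℕ) (ModuleCat.ofHom (sPos h n))
        (ModuleCat.ofHom (sPos h (n + 1))) ?_
      refine ModuleCat.hom_ext (LinearMap.ext fun x => funext fun t => ?_)
      refine (hf (x t)).trans ((cyl_pos h n x t).trans ?_)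
      rw [← groupCohomology.inhomogeneousCochains.d_def, ← groupCohomology.inhomogeneousCochains.d_def]
      rfl
  · obtain _ | n := n
    · refine homologyMap_eq_zero (tateComplex.map f) (.negSucc 1) (.negSucc 0) 0 (ModuleCat.ofHom (sNeg h 0)) (ModuleCat.ofHom e) ?_
      refine ModuleCat.hom_ext (Finsupp.lhom_ext fun t m => ?_)
      change ((groupHomology.chainsMap (.id G) f).f 0).hom (Finsupp.single t m) =
        ((groupHomology.inhomogeneousChains N).d 1 0).hom (sNeg h 0 (Finsupp.single t m)) +
          e ((M.tateNorm).hom (Finsupp.single t m))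
      rw [groupHomology.inhomogeneousChains.d_def, Rep.tateNorm_eq]
      have h1 : (ModuleCat.ofHom (Finsupp.lsum k fun _ : Fin 0 → G =>
          LinearMap.pi fun _ : Fin 0 → G => M.ρ.norm)).hom (Finsupp.single t m) =
          fun _ => M.ρ.norm m := by
        ext; simp
      refine Eq.trans ?_ (congrArg (fun y => _ + e y) h1.symm)
      have h2 : dNeg N 0 (sNeg h 0 (Finsupp.single t m)) =
          Finsupp.single t (∑ g : G, (N.ρ g (h (M.ρ g⁻¹ m)) - h (M.ρ g m))) := by
        rw [Finset.sum_sub_distrib, ← Equiv.sum_comp (Equiv.inv G)]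
        simp only [sNeg, Finsupp.lsum_single, LinearMap.sum_apply, LinearMap.comp_apply,
          Finsupp.lsingle_apply, map_sum, d_single', Finsupp.single_sub, Finsupp.single_finsetSum]
        rw [← Finset.sum_sub_distrib]
        refine Finset.sum_congr rfl fun g _ => ?_
        simp [Subsingleton.elim _ t, sub_eq_add_neg]
      refine Eq.trans ?_ (congrArg (· + _) h2.symm)
      simp [groupHomology.chainsMap_id_f_hom_eq_mapRange, e, hf, Subsingleton.elim default t, Representation.norm, Finsupp.single_sub,
        ← Finsupp.single_finsetSum]
    · refine homologyMap_eq_zero _ (.negSucc (n + 2)) (.negSucc (n + 1)) (.negSucc n) (ModuleCat.ofHom (sNeg h (n + 1)))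
        (ModuleCat.ofHom (sNeg h n)) ?_
      refine ModuleCat.hom_ext (Finsupp.lhom_ext fun t m => ?_)
      have := cyl_neg h n t m
      rw [dNeg, dNeg, ← groupHomology.inhomogeneousChains.d_def, ← groupHomology.inhomogeneousChains.d_def, ← hf] at this
      refine Eq.trans ?_ this
      change ((groupHomology.chainsMap (.id G) f).f (n+1)).hom (Finsupp.single t m) = _
      simp [groupHomology.chainsMap_id_f_hom_eq_mapRange]
     

/-- The induced module: functions `f : G → M` with `(g f)(x) = g (f (g⁻¹ x))`. Since `G` is finite,
this is `ℤ[G] ⊗ M ≅ Hom(ℤ[G], M)`. -/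
abbrev ind (M : Rep.{u} k G) : Rep.{u} k G :=
  Rep.of (X := G → M)
    { toFun := fun g => LinearMap.pi fun x => M.ρ g ∘ₗ LinearMap.proj (g⁻¹ * x)
      map_one' := by ext; simp
      map_mul' := by intro a b; ext; simp [mul_assoc] }

/-- The embedding `M ⟶ ind M` onto the constant functions. -/
def indUnit (M : Rep.{u} k G) : M ⟶ ind M :=
  Rep.ofHom ⟨LinearMap.pi fun _ => LinearMap.id, fun g => by ext; simp⟩

/-- The surjection `ind M ⟶ M`, `f ↦ ∑ x, f x`. -/
def indSum (M : Rep.{u} k G) : ind M ⟶ M :=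
  Rep.ofHom ⟨∑ x : G, LinearMap.proj x, fun g => by
    refine LinearMap.ext fun f => ?_
    simp only [LinearMap.comp_apply, LinearMap.sum_apply, LinearMap.proj_apply, map_sum]
    exact Equiv.sum_comp (Equiv.mulLeft g⁻¹) (fun x => M.ρ g (f x))⟩

/-- Induced modules have no Tate cohomology. -/
theorem isZero_ind (M : Rep.{u} k G) (n : ℤ) : Limits.IsZero (tateCohomology (ind M) n) := by
  classical
  rw [Limits.IsZero.iff_id_eq_zero]
  rw [← (tateCohomologyFunctor n).map_id (ind M)]
  refine tateMap_eq_zero (M := ind M) (N := ind M) (LinearMap.single k _ 1 ∘ₗ LinearMap.proj 1) _ (fun f => ?_) n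
  ext x
  simp only [Rep.hom_id, Finset.sum_apply, LinearMap.comp_apply, LinearMap.pi_apply, MonoidHom.coe_mk,
    OneHom.coe_mk, LinearMap.proj_apply, LinearMap.single_apply, Pi.single_apply, inv_mul_eq_one]
  rw [Finset.sum_eq_single x (fun g _ hg => by simp [hg]) (by simp)]
  simp

/-- `Σ M`, the quotient of `ind M` by the constant functions. -/
def sigma (M : Rep.{u} k G) : Rep.{u} k G :=
  Rep.quotient (ind M) (LinearMap.range (indUnit M).hom.toLinearMap) (by
    rintro g _ ⟨m, rfl⟩
    exact ⟨M.ρ g m, Rep.hom_comm_apply (indUnit M) g m⟩)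

/-- `Ω M`, the submodule of `ind M` of functions with sum zero (isomorphic to `I_G ⊗ M`). -/
def omega (M : Rep.{u} k G) : Rep.{u} k G :=
  Rep.subrepresentation (ind M) (LinearMap.ker (indSum M).hom.toLinearMap) (by
    intro g f hf
    have := Rep.hom_comm_apply (indSum M) g f
    rw [LinearMap.mem_ker] at hf
    change (indSum M).hom f = 0 at hf
    change (indSum M).hom _ = 0
    rw [this, hf, map_zero])

/-- The `ℤ`-split sequence `0 ⟶ M ⟶ ind M ⟶ Σ M ⟶ 0`. -/
def upSeq (M : Rep.{u} k G) : ShortComplex (Rep.{u} k G) where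
  X₁ := M
  X₂ := ind M
  X₃ := sigma M
  f := indUnit M
  g := Rep.mkQ _ _ _
  zero := by
    ext m
    exact (Submodule.Quotient.mk_eq_zero _).2 ⟨m, rfl⟩

/-- The `ℤ`-split sequence `0 ⟶ Ω M ⟶ ind M ⟶ M ⟶ 0`. -/
def downSeq (M : Rep.{u} k G) : ShortComplex (Rep.{u} k G) where
  X₁ := omega M
  X₂ := ind M
  X₃ := M
  f := Rep.subtype _ _ _
  g := indSum M
  zero := by
    ext m
    exact m.2

theorem shortExact_of (S : ShortComplex (Rep.{u} k G)) (h1 : Function.Injective S.f.hom)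
    (h2 : Function.Surjective S.g.hom) (h3 : ∀ x, S.g.hom x = 0 → ∃ y, S.f.hom y = x) :
    S.ShortExact where
  exact := by
    rw [← ShortComplex.exact_map_iff_of_faithful _ (forget₂ (Rep k G) (ModuleCat k)),
      ShortComplex.moduleCat_exact_iff]
    exact h3
  mono_f := (Rep.mono_iff_injective _).2 h1
  epi_g := (Rep.epi_iff_surjective _).2 h2

theorem upSeq_shortExact (M : Rep.{u} k G) : (upSeq M).ShortExact :=
  shortExact_of _ (fun _ _ h => congrFun h (1 : G)) (Submodule.mkQ_surjective _)
    fun _ h => (Submodule.Quotient.mk_eq_zero _).1 h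

theorem downSeq_shortExact (M : Rep.{u} k G) : (downSeq M).ShortExact := by
  classical
  refine shortExact_of _ Subtype.val_injective (fun m => ⟨(Pi.single 1 m : G → M), ?_⟩)
    fun x h => ⟨⟨x, h⟩, rfl⟩
  change (∑ x : G, LinearMap.proj x : (G → M) →ₗ[k] M) _ = m
  rw [LinearMap.sum_apply]
  exact (Finset.sum_eq_single (1 : G) (fun g _ hg => Pi.single_eq_of_ne hg _) (by simp)).trans
    (Pi.single_eq_same (M := fun _ : G => (M : Type u)) 1 m)

/-- The connecting isomorphism `Ĥⁿ(G, Σ M) ≅ Ĥⁿ⁺¹(G, M)` of `0 ⟶ M ⟶ ind M ⟶ Σ M ⟶ 0`. -/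
def deltaUp (M : Rep.{u} k G) (n m : ℤ) (h : n + 1 = m) :
    tateCohomology (sigma M) n ≃+ tateCohomology M m :=
  ((TateCohomology.map_tateComplexFunctor_shortExact (upSeq_shortExact M)).δIso n m h
    (isZero_ind M n) (isZero_ind M m)).toLinearEquiv.toAddEquiv

/-- The connecting isomorphism `Ĥⁿ(G, M) ≅ Ĥⁿ⁺¹(G, Ω M)` of `0 ⟶ Ω M ⟶ ind M ⟶ M ⟶ 0`. -/
def deltaDown (M : Rep.{u} k G) (n m : ℤ) (h : n + 1 = m) :
    tateCohomology M n ≃+ tateCohomology (omega M) m :=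
  ((TateCohomology.map_tateComplexFunctor_shortExact (downSeq_shortExact M)).δIso n m h
    (isZero_ind M n) (isZero_ind M m)).toLinearEquiv.toAddEquiv


/-- The canonical map `ind A ⊗ B ⟶ ind (A ⊗ B)`, `f ⊗ b ↦ (x ↦ f x ⊗ b)`. -/
def indTensor (A B : Rep.{u} k G) : ind A ⊗ B ⟶ ind (A ⊗ B) :=
  Rep.ofHom (ρ := (ind A).ρ.tprod B.ρ) (σ := (ind (A ⊗ B)).ρ)
    ⟨LinearMap.pi fun x => (LinearMap.proj x : (G → A) →ₗ[k] A).rTensor B, fun g => by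
      refine TensorProduct.ext' fun f b => ?_
      rfl⟩

/-- The canonical map `Σ A ⊗ B ⟶ Σ (A ⊗ B)` induced by `indTensor` on quotients. -/
def sigmaTensor (A B : Rep.{u} k G) : sigma A ⊗ B ⟶ sigma (A ⊗ B) :=
  Rep.ofHom (ρ := (sigma A).ρ.tprod B.ρ) (σ := (sigma (A ⊗ B)).ρ)
    ⟨TensorProduct.lift (Submodule.liftQ _
      (TensorProduct.curry ((upSeq (A ⊗ B)).g.hom.toLinearMap ∘ₗ (indTensor A B).hom.toLinearMap)) (by
        rintro _ ⟨a, rfl⟩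
        refine LinearMap.ext fun b => (Submodule.Quotient.mk_eq_zero _).2 ⟨a ⊗ₜ[k] b, rfl⟩)), fun g => by
      refine TensorProduct.ext' fun f b => ?_
      obtain ⟨f, rfl⟩ := Submodule.mkQ_surjective _ f
      rfl⟩

/-- The canonical map `Ω A ⊗ B ⟶ Ω (A ⊗ B)` induced by `indTensor` on submodules. -/
def omegaTensor (A B : Rep.{u} k G) : omega A ⊗ B ⟶ omega (A ⊗ B) :=
  Rep.ofHom (ρ := (omega A).ρ.tprod B.ρ) (σ := (omega (A ⊗ B)).ρ)
    ⟨LinearMap.codRestrict _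
      ((indTensor A B).hom.toLinearMap ∘ₗ ((downSeq A).f.hom.toLinearMap.rTensor B)) (by
        intro z
        induction z using TensorProduct.induction_on with
        | zero => simp
        | add x y hx hy => rw [map_add]; exact Submodule.add_mem _ hx hy
        | tmul f b =>
          have h0 : (∑ x : G, LinearMap.proj x : (G → A) →ₗ[k] A) f.1 = 0 := f.2
          change (∑ x : G, LinearMap.proj x : (G → TensorProduct k A B) →ₗ[k] _)
            (fun x => f.1 x ⊗ₜ[k] b) = 0
          rw [LinearMap.sum_apply] at h0 ⊢
          exact (TensorProduct.sum_tmul _ _ _).symm.trans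
            ((congrArg (fun a => a ⊗ₜ[k] b) h0).trans (TensorProduct.zero_tmul _ _))), fun g => by
      refine TensorProduct.ext' fun f b => ?_
      rfl⟩

/-- For a `G`-invariant `a ∈ A`, the morphism `B ⟶ A ⊗ B`, `b ↦ a ⊗ b`. -/
def tmulLeft (A B : Rep.{u} k G) (a : A.ρ.invariants) : B ⟶ A ⊗ B :=
  Rep.ofHom (ρ := B.ρ) (σ := A.ρ.tprod B.ρ) ⟨TensorProduct.mk k A B a.1, fun g => by
    ext b
    simp [a.2 g]⟩

instance (n : ℤ) : (tateCohomologyFunctor (R := k) (G := G) n).Additive :=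
  inferInstanceAs (tateComplexFunctor k G ⋙ HomologicalComplex.homologyFunctor _ _ n).Additive

/-- The map induced by a morphism of `G`-modules on Tate cohomology. -/
def tateMap {A B : Rep.{u} k G} (f : A ⟶ B) (n : ℤ) : tateCohomology A n →+ tateCohomology B n :=
  ((tateCohomologyFunctor n).map f).hom.toAddMonoidHom

theorem tateMap_zero (A B : Rep.{u} k G) (n : ℤ) : tateMap (0 : A ⟶ B) n = 0 := by
  ext; simp [tateMap]

theorem tateMap_add {A B : Rep.{u} k G} (f g : A ⟶ B) (n : ℤ) :
    tateMap (f + g) n = tateMap f n + tateMap g n := by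
  ext; simp [tateMap, Functor.map_add]

theorem tmulLeft_zero (A B : Rep.{u} k G) : tmulLeft A B 0 = 0 :=
  Rep.hom_ext (Representation.IntertwiningMap.ext
    (LinearMap.ext fun _ => TensorProduct.zero_tmul _ _))

theorem tmulLeft_add (A B : Rep.{u} k G) (a a' : A.ρ.invariants) :
    tmulLeft A B (a + a') = tmulLeft A B a + tmulLeft A B a' :=
  Rep.hom_ext (Representation.IntertwiningMap.ext
    (LinearMap.ext fun _ => TensorProduct.add_tmul _ _ _))

/-- A Tate `0`-cocycle is a `G`-invariant element of `A`. -/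
def cocycleValue (A : Rep.{u} k G) : (tateComplex A).cycles 0 →+ A.ρ.invariants where
  toFun z := ⟨((tateComplex A).iCycles 0).hom z (default : Fin 0 → G), fun g => by
    have h := congrArg (fun f => f.hom z) ((tateComplex A).iCycles_d 0 1)
    have h' : (inhomogeneousCochains.d A 0).hom (((tateComplex A).iCycles 0).hom z) = 0 := by
      rw [← groupCohomology.inhomogeneousCochains.d_def]
      exact h
    have h2 : _ = (0 : A) := (inhomogeneousCochains.d_hom_apply A 0 _ fun _ => g).symm.trans
      (congrFun h' fun _ => g)
    simpa [add_neg_eq_zero, Subsingleton.elim _ (default : Fin 0 → G)] using h2⟩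
  map_zero' := by ext; simp; rfl
  map_add' x y := by ext; simp; rfl

/-- A Tate `0`-cocycle with trivial class is a norm. -/
theorem cocycleValue_ker (A : Rep.{u} k G) (z : (tateComplex A).cycles 0)
    (hz : ((tateComplex A).homologyπ 0).hom z = 0) :
    ∃ a : A, (cocycleValue A z : A) = ∑ g : G, A.ρ g a := by
  have hex := ShortComplex.exact_of_g_is_cokernel
    (ShortComplex.mk _ _ ((tateComplex A).toCycles_comp_homologyπ (-1) 0))
    ((tateComplex A).homologyIsCokernel (-1) 0 (by simp))
  rw [ShortComplex.moduleCat_exact_iff] at hex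
  obtain ⟨y, rfl⟩ := hex z hz
  have h1 : ((tateComplex A).iCycles 0).hom (((tateComplex A).toCycles (-1) 0).hom y) =
      (A.tateNorm).hom y :=
    congrArg (fun f => f.hom y) ((tateComplex A).toCycles_i (-1) 0)
  rw [Rep.tateNorm_eq] at h1
  let y' : (Fin 0 → G) →₀ A := y
  have hy : y = Finsupp.single default (y' default) := Finsupp.unique_single y'
  refine ⟨y' default, (congrFun h1 default).trans ?_⟩
  rw [hy]
  refine (congrFun (Finsupp.lsum_single k
    (fun _ : Fin 0 → G => LinearMap.pi fun _ : Fin 0 → G => A.ρ.norm) default _) default).trans ?_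
  simp [Representation.norm]

/-- Cup product with a class of degree zero: `[a] ∪ β` is the image of `β` under the map induced by
`b ↦ a ⊗ b`, where `Ĥ⁰(G, A) = A^G / N_G A` and `a ∈ A^G`. -/
def cupZero (A B : Rep.{u} k G) (q : ℤ) :
    tateCohomology A 0 →+ tateCohomology B q →+ tateCohomology (A ⊗ B) q :=
  AddMonoidHom.liftOfSurjective ((tateComplex A).homologyπ 0).hom.toAddMonoidHom
    ((ModuleCat.epi_iff_surjective _).1 inferInstance)
    ⟨{ toFun z := tateMap (tmulLeft A B (cocycleValue A z)) q
       map_zero' := by rw [map_zero, tmulLeft_zero, tateMap_zero]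
       map_add' x y := by rw [map_add, tmulLeft_add, tateMap_add] }, fun z hz => by
      obtain ⟨a, ha⟩ := cocycleValue_ker A z hz
      refine AddMonoidHom.ext fun b => ?_
      refine congrArg (fun f => f.hom b) (tateMap_eq_zero (TensorProduct.mk k A B a)
        (tmulLeft A B (cocycleValue A z)) (fun b => ?_) q)
      change (cocycleValue A z : A) ⊗ₜ[k] b = ∑ g : G, A.ρ g a ⊗ₜ[k] B.ρ g (B.ρ g⁻¹ b)
      rw [ha, TensorProduct.sum_tmul]
      simp⟩

/-- Transport along an equality of degrees. -/
def degCast (A : Rep.{u} k G) {m n : ℤ} (h : m = n) : tateCohomology A m ≃+ tateCohomology A n :=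
  h ▸ AddEquiv.refl _

/-- The cup product `Ĥᵖ(G, A) × Ĥ^q(G, B) → Ĥᵖ⁺^q(G, A ⊗ B)` for `p ≥ 0`, by dimension shifting in
`A`: it is determined by `cupZero` and the rule `δ α ∪ β = δ (α ∪ β)`, where the `δ` are the
connecting isomorphisms of `0 ⟶ A ⟶ ind A ⟶ Σ A ⟶ 0` and of the same sequence for `A ⊗ B`. -/
def cupNonneg : (p : ℕ) → (A B : Rep.{u} k G) → (q n : ℤ) → (p : ℤ) + q = n →
    (tateCohomology A p →+ tateCohomology B q →+ tateCohomology (A ⊗ B) n)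
  | 0, A, B, q, n, h => (cupZero A B q).compr₂ (degCast (A ⊗ B) (by simpa using h)).toAddMonoidHom
  | p + 1, A, B, q, n, h =>
    ((cupNonneg p (sigma A) B q (n - 1) (by push_cast at h; lia)).compr₂
      ((deltaUp (A ⊗ B) (n - 1) n (by lia)).toAddMonoidHom.comp
        (tateMap (sigmaTensor A B) (n - 1)))).comp
      (deltaUp A p (p + 1 : ℕ) (by simp)).symm.toAddMonoidHom

/-- The cup product `Ĥ⁻ᵖ(G, A) × Ĥ^q(G, B) → Ĥ^(q-p)(G, A ⊗ B)` for `p ≥ 0`, by dimension shifting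
in `A`: it is determined by `cupZero` and the rule `δ (α ∪ β) = δ α ∪ β`, where the `δ` are the
connecting isomorphisms of `0 ⟶ Ω A ⟶ ind A ⟶ A ⟶ 0` and of the same sequence for `A ⊗ B`. -/
def cupNonpos : (p : ℕ) → (A B : Rep.{u} k G) → (q n : ℤ) → -(p : ℤ) + q = n →
    (tateCohomology A (-(p : ℤ)) →+ tateCohomology B q →+ tateCohomology (A ⊗ B) n)
  | 0, A, B, q, n, h => cupNonneg 0 A B q n (by simpa using h)
  | p + 1, A, B, q, n, h =>
    ((cupNonpos p (omega A) B q (n + 1) (by push_cast at h; lia)).compr₂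
      ((deltaDown (A ⊗ B) n (n + 1) rfl).symm.toAddMonoidHom.comp
        (tateMap (omegaTensor A B) (n + 1)))).comp
      (deltaDown A (-((p + 1 : ℕ) : ℤ)) (-(p : ℤ)) (by push_cast; lia)).toAddMonoidHom

/-- The cup product `Ĥᵖ(G, A) × Ĥ^q(G, B) → Ĥᵖ⁺^q(G, A ⊗ B)` in Tate cohomology, for all integers
`p` and `q`. This is the standard cup product: it is the only family of products that is natural in
`A`, is given by `([a], β) ↦ (a ⊗ -)_* β` when `p = 0`, and satisfies `δ α ∪ β = δ (α ∪ β)` for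
the connecting maps of `ℤ`-split short exact sequences in the first variable. -/
def cup (A B : Rep.{u} k G) : (p q n : ℤ) → p + q = n →
    (tateCohomology A p →+ tateCohomology B q →+ tateCohomology (A ⊗ B) n)
  | .ofNat p, q, n, h => cupNonneg p A B q n h
  | .negSucc p, q, n, h => cupNonpos (p + 1) A B q n h

/-- The composition map `Hom(X, A) ⊗ Hom(X', X) ⟶ Hom(X', A)`, `f ⊗ φ ↦ f ∘ φ`. -/
def homComp (X X' A : Rep.{u} k G) :
    (Rep.ihom X).obj A ⊗ (Rep.ihom X').obj X ⟶ (Rep.ihom X').obj A :=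
  Rep.ofHom (ρ := (Representation.linHom X.ρ A.ρ).tprod (Representation.linHom X'.ρ X.ρ))
    (σ := Representation.linHom X'.ρ A.ρ)
    ⟨TensorProduct.lift (LinearMap.llcomp k X' X A), fun g => by
      refine TensorProduct.ext' fun f b => ?_
      ext x
      simp⟩

/-- The product `(a, x) ↦ a ∪ x` induced by composition, i.e. the composite
`Ĥˢ(G, Hom(X, A)) × Ĥʳ(G, Hom(X', X)) → Ĥˢ⁺ʳ(G, Hom(X, A) ⊗ Hom(X', X)) → Ĥˢ⁺ʳ(G, Hom(X', A))`. -/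
def homCup (X X' A : Rep.{u} k G) (s r n : ℤ) (h : s + r = n) :
    tateCohomology ((Rep.ihom X).obj A) s →+ tateCohomology ((Rep.ihom X').obj X) r →+
      tateCohomology ((Rep.ihom X').obj A) n :=
  (cup _ _ s r n h).compr₂ (tateMap (homComp X X' A) n)

end TateCup

end

/-!
The proof reduces to degree `s = 0` by dimension shifting, and in degree zero it is the Yoneda lemma.

In degree zero, a class in `Ĥ⁰(G, Hom(X, A))` is represented by a morphism `f : X ⟶ A`, hence is the
image `f_* [id_X]` of the class of the identity. So a natural family `Φ` is determined by
`Φ_X [id_X] ∈ Ĥʳ(G, Hom(X', X))`, and since `[f] ∪ x = f_* x`, that element is the one class that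
represents `Φ` (`representable_zero`).

The sequences `0 ⟶ A ⟶ ind A ⟶ Σ A ⟶ 0` and `0 ⟶ Ω A ⟶ ind A ⟶ A ⟶ 0` split linearly, so they stay
exact after `Hom(X, -)`, and `Hom(X, ind A)` has no Tate cohomology. They give isomorphisms
`Ĥˢ(G, Hom(X, Σ A)) ≅ Ĥˢ⁺¹(G, Hom(X, A))` (`homUp`) and
`Ĥˢ(G, Hom(X, A)) ≅ Ĥˢ⁺¹(G, Hom(X, Ω A))` (`homDown`). The product `homCup` is natural in `A` and
commutes with both of them in every degree (`homCup_homUp`, `homCup_homDown`). The recursive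
definition of the cup product gives the rule for `Σ` in nonnegative degrees and the rule for `Ω` in
negative degrees, once `Σ Hom(X, A)` is compared with `Hom(X, Σ A)` and likewise for `Ω`; the
remaining cases follow by naturality along the canonical maps `A ⟶ Σ Ω A` and `Ω Σ A ⟶ A`, which
identify the two kinds of connecting isomorphism (`homDown_eq`, `homUp_eq`).

Conjugation by these isomorphisms turns a natural family in degree `s + 1` into one in degree `s`
and conversely, with the same representing classes (`Representable.succ`, `Representable.pred`).
-/

noncomputable section

namespace TateCup

open MonoidalCategory

set_option linter.unusedSectionVars false

universe u
variable {k G : Type u} [CommRing k] [Group G] [Fintype G]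

/-! ### Induced maps and connecting isomorphisms in Tate cohomology -/

theorem tateMap_id (A : Rep.{u} k G) (n : ℤ) (a : tateCohomology A n) : tateMap (𝟙 A) n a = a := by
  simp [tateMap]

theorem tateMap_comp {A B C : Rep.{u} k G} (f : A ⟶ B) (g : B ⟶ C) (n : ℤ)
    (a : tateCohomology A n) : tateMap (f ≫ g) n a = tateMap g n (tateMap f n a) := by
  simp [tateMap]

theorem tateMap_comm {A B C D : Rep.{u} k G} {f : A ⟶ B} {g : B ⟶ D} {f' : A ⟶ C} {g' : C ⟶ D}
    (h : f ≫ g = f' ≫ g') (n : ℤ) (a : tateCohomology A n) :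
    tateMap g n (tateMap f n a) = tateMap g' n (tateMap f' n a) := by
  rw [← tateMap_comp, h, tateMap_comp]

/-- The connecting isomorphism `Ĥⁿ(G, S.X₃) ≅ Ĥⁿ⁺¹(G, S.X₁)` of a short exact sequence `S` whose
middle term has no Tate cohomology. -/
def delta {S : ShortComplex (Rep.{u} k G)} (hS : S.ShortExact)
    (h₂ : ∀ n, Limits.IsZero (tateCohomology S.X₂ n)) (n m : ℤ) (h : n + 1 = m) :
    tateCohomology S.X₃ n ≃+ tateCohomology S.X₁ m :=
  ((TateCohomology.map_tateComplexFunctor_shortExact hS).δIso n m h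
    (h₂ n) (h₂ m)).toLinearEquiv.toAddEquiv

theorem delta_naturality {S T : ShortComplex (Rep.{u} k G)} (hS : S.ShortExact)
    (hS₂ : ∀ n, Limits.IsZero (tateCohomology S.X₂ n)) (hT : T.ShortExact)
    (hT₂ : ∀ n, Limits.IsZero (tateCohomology T.X₂ n)) (F : S ⟶ T) (n m : ℤ) (h : n + 1 = m)
    (a : tateCohomology S.X₃ n) :
    tateMap F.τ₁ m (delta hS hS₂ n m h a) = delta hT hT₂ n m h (tateMap F.τ₃ n a) :=
  congrArg (fun f => f.hom a) (HomologicalComplex.HomologySequence.δ_naturality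
    ((tateComplexFunctor k G).mapShortComplex.map F)
    (TateCohomology.map_tateComplexFunctor_shortExact hS)
    (TateCohomology.map_tateComplexFunctor_shortExact hT) n m h)

/-! ### Morphisms between the dimension-shifting sequences -/

/-- `ind` on morphisms. -/
def indMap {A B : Rep.{u} k G} (f : A ⟶ B) : ind A ⟶ ind B :=
  Rep.ofHom ⟨f.hom.toLinearMap.compLeft G, fun g => by
    refine LinearMap.ext fun v => funext fun x => ?_
    exact Rep.hom_comm_apply f g _⟩

/-- The `G`-morphism `M ⟶ ind N` attached to a linear map `h : M → N`, given by
`m ↦ (x ↦ x h (x⁻¹ m))`. -/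
def toInd {M N : Rep.{u} k G} (h : M →ₗ[k] N) : M ⟶ ind N :=
  Rep.ofHom ⟨LinearMap.pi fun x => N.ρ x ∘ₗ h ∘ₗ M.ρ x⁻¹, fun g => by
    refine LinearMap.ext fun v => funext fun x => ?_
    simp [← Module.End.mul_apply, ← map_mul]⟩

/-- The `G`-morphism `ind M ⟶ N` attached to a linear map `h : M → N`, given by
`v ↦ ∑ x, x h (x⁻¹ (v x))`. -/
def ofInd {M N : Rep.{u} k G} (h : M →ₗ[k] N) : ind M ⟶ N :=
  Rep.ofHom ⟨∑ x : G, N.ρ x ∘ₗ h ∘ₗ M.ρ x⁻¹ ∘ₗ LinearMap.proj x, fun g => by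
    refine LinearMap.ext fun v => ?_
    simp only [LinearMap.comp_apply, LinearMap.sum_apply, LinearMap.proj_apply, map_sum]
    rw [← Equiv.sum_comp (Equiv.mulLeft g)]
    refine Finset.sum_congr rfl fun x _ => ?_
    simp [← Module.End.mul_apply, ← map_mul]⟩

theorem indSum_apply (A : Rep.{u} k G) (v : G → A) : (indSum A).hom v = ∑ x, v x :=
  LinearMap.sum_apply _ _ v

theorem ofInd_apply {M N : Rep.{u} k G} (h : M →ₗ[k] N) (v : G → M) :
    (ofInd h).hom v = ∑ x, N.ρ x (h (M.ρ x⁻¹ (v x))) :=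
  LinearMap.sum_apply _ _ v

/-- A morphism from a short exact sequence, given on the first two terms. -/
def homOfLeft {S T : ShortComplex (Rep.{u} k G)} (hS : S.ShortExact) (f₁ : S.X₁ ⟶ T.X₁)
    (f₂ : S.X₂ ⟶ T.X₂) (h : f₁ ≫ T.f = S.f ≫ f₂) : S ⟶ T where
  τ₁ := f₁
  τ₂ := f₂
  τ₃ := haveI := hS.epi_g
    hS.exact.desc (f₂ ≫ T.g) (by rw [← Category.assoc, ← h, Category.assoc, T.zero, Limits.comp_zero])
  comm₁₂ := h
  comm₂₃ := by
    have := hS.epi_g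
    exact (hS.exact.g_desc _ _).symm

/-- A morphism to a short exact sequence, given on the last two terms. -/
def homOfRight {S T : ShortComplex (Rep.{u} k G)} (hT : T.ShortExact) (f₂ : S.X₂ ⟶ T.X₂)
    (f₃ : S.X₃ ⟶ T.X₃) (h : f₂ ≫ T.g = S.g ≫ f₃) : S ⟶ T where
  τ₁ := haveI := hT.mono_f
    hT.exact.lift (S.f ≫ f₂) (by rw [Category.assoc, h, ← Category.assoc, S.zero, Limits.zero_comp])
  τ₂ := f₂
  τ₃ := f₃
  comm₁₂ := by
    have := hT.mono_f
    exact hT.exact.lift_f _ _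
  comm₂₃ := h

/-- `upSeq` on morphisms. -/
def upSeqMap {A B : Rep.{u} k G} (f : A ⟶ B) : upSeq A ⟶ upSeq B :=
  homOfLeft (upSeq_shortExact A) f (indMap f) rfl

/-- `downSeq` on morphisms. -/
def downSeqMap {A B : Rep.{u} k G} (f : A ⟶ B) : downSeq A ⟶ downSeq B :=
  homOfRight (downSeq_shortExact B) (indMap f) f (by
    refine Rep.hom_ext (Representation.IntertwiningMap.ext (LinearMap.ext fun v => ?_))
    refine (indSum_apply B _).trans (Eq.trans ?_ (congrArg f.hom (indSum_apply A v)).symm)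
    exact (map_sum f.hom _ _).symm)

/-- `Σ` on morphisms. -/
def sigmaMap {A B : Rep.{u} k G} (f : A ⟶ B) : sigma A ⟶ sigma B := (upSeqMap f).τ₃

/-- `Ω` on morphisms. -/
def omegaMap {A B : Rep.{u} k G} (f : A ⟶ B) : omega A ⟶ omega B := (downSeqMap f).τ₁

/-- The linear map `A → ind A` onto the functions supported at `1`, a section of `indSum A`. -/
def downSection (A : Rep.{u} k G) : A →ₗ[k] ind A := by
  classical exact LinearMap.single k (fun _ : G => (A : Type u)) 1

theorem downSection_spec (A : Rep.{u} k G) (a : A) : (downSeq A).g.hom (downSection A a) = a := by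
  classical
  refine (indSum_apply A _).trans ?_
  exact (Finset.sum_eq_single (1 : G) (fun g _ hg => Pi.single_eq_of_ne hg _) (by simp)).trans
    (Pi.single_eq_same (M := fun _ : G => (A : Type u)) 1 a)

/-- The linear section `[v] ↦ v - v 1` of the quotient map `ind A → Σ A`. -/
def upSection (A : Rep.{u} k G) : sigma A →ₗ[k] ind A :=
  Submodule.liftQ _ (LinearMap.id - (indUnit A).hom.toLinearMap ∘ₗ LinearMap.proj 1) (by
    rintro _ ⟨a, rfl⟩
    exact sub_self _)

theorem upSection_spec (A : Rep.{u} k G) (c : sigma A) :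
    (upSeq A).g.hom (upSection A c) = c := by
  obtain ⟨v, rfl⟩ := Submodule.mkQ_surjective _ c
  exact (Submodule.Quotient.eq _).2 (by
    refine ⟨-((v : G → A) 1), ?_⟩
    change (indUnit A).hom _ = v - (indUnit A).hom ((v : G → A) 1) - v
    rw [map_neg]
    abel)

/-- The linear retraction `v ↦ v - (∑ x, v x) δ₁` of the inclusion `Ω A → ind A`. -/
def downRetraction (A : Rep.{u} k G) : ind A →ₗ[k] omega A :=
  LinearMap.codRestrict _ (LinearMap.id - downSection A ∘ₗ (indSum A).hom.toLinearMap) fun v => by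
    change (indSum A).hom (v - downSection A ((indSum A).hom v)) = 0
    rw [map_sub]
    exact sub_eq_zero.2 (downSection_spec A _).symm

theorem downRetraction_spec (A : Rep.{u} k G) (v : omega A) :
    downRetraction A ((downSeq A).f.hom v) = v := by
  refine Subtype.ext ?_
  change v.1 - downSection A ((indSum A).hom v.1) = v.1
  rw [show (indSum A).hom v.1 = 0 from v.2, map_zero, sub_zero]

/-- A morphism of extensions from `0 ⟶ Ω A ⟶ ind A ⟶ A ⟶ 0` to the sequence
`0 ⟶ Ω A ⟶ ind (Ω A) ⟶ Σ (Ω A) ⟶ 0` that is the identity on `Ω A`. -/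
def downSeqToUpSeq (A : Rep.{u} k G) : downSeq A ⟶ upSeq (omega A) :=
  homOfLeft (downSeq_shortExact A) (𝟙 _) (toInd (downRetraction A)) (by
    refine Rep.hom_ext (Representation.IntertwiningMap.ext (LinearMap.ext fun v => funext fun x => ?_))
    change v = (omega A).ρ x (downRetraction A ((ind A).ρ x⁻¹ ((downSeq A).f.hom v)))
    erw [← Rep.hom_comm_apply (downSeq A).f x⁻¹ v, downRetraction_spec]
    exact ((omega A).ρ.self_inv_apply x v).symm)

/-- The canonical map `A ⟶ Σ Ω A`, inducing an isomorphism on Tate cohomology. -/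
def toSigmaOmega (A : Rep.{u} k G) : A ⟶ sigma (omega A) := (downSeqToUpSeq A).τ₃

/-- A morphism of extensions from `0 ⟶ Ω (Σ A) ⟶ ind (Σ A) ⟶ Σ A ⟶ 0` to the sequence
`0 ⟶ A ⟶ ind A ⟶ Σ A ⟶ 0` that is the identity on `Σ A`. -/
def downSeqSigmaToUpSeq (A : Rep.{u} k G) : downSeq (sigma A) ⟶ upSeq A :=
  homOfRight (upSeq_shortExact A) (ofInd (upSection A)) (𝟙 _) (by
    refine Rep.hom_ext (Representation.IntertwiningMap.ext (LinearMap.ext fun v => ?_))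
    refine (congrArg (upSeq A).g.hom (ofInd_apply _ v)).trans
      (((map_sum (upSeq A).g.hom _ _).trans ?_).trans (indSum_apply (sigma A) v).symm)
    refine Finset.sum_congr rfl fun x _ => ?_
    refine (Rep.hom_comm_apply (upSeq A).g x _).trans ?_
    refine (congrArg ((sigma A).ρ x) (upSection_spec A _)).trans ?_
    exact (sigma A).ρ.self_inv_apply x _)

/-- The canonical map `Ω Σ A ⟶ A`, inducing an isomorphism on Tate cohomology. -/
def ofOmegaSigma (A : Rep.{u} k G) : omega (sigma A) ⟶ A := (downSeqSigmaToUpSeq A).τ₁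

/-! ### Dimension shifting for `Hom(X, -)` -/

instance (X : Rep.{u} k G) : (Rep.ihom X).PreservesZeroMorphisms where
  map_zero _ _ := by ext; rfl

/-- `Hom(X, -)` preserves short exact sequences that are split over `k`. -/
theorem ihom_shortExact (X : Rep.{u} k G) {S : ShortComplex (Rep.{u} k G)} (hS : S.ShortExact)
    (σ : S.X₃ →ₗ[k] S.X₂) (hσ : ∀ c, S.g.hom (σ c) = c) : (S.map (Rep.ihom X)).ShortExact := by
  have hf : Function.Injective S.f.hom := (Rep.mono_iff_injective _).1 hS.mono_f
  have hex := hS.exact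
  rw [← ShortComplex.exact_map_iff_of_faithful _ (forget₂ (Rep k G) (ModuleCat k)),
    ShortComplex.moduleCat_exact_iff] at hex
  refine shortExact_of _ (fun f f' h => ?_) (fun f => ?_) fun f hf0 => ?_
  · refine LinearMap.ext fun x => hf ?_
    exact congrArg (fun φ : X →ₗ[k] S.X₂ => φ x) h
  · exact ⟨σ ∘ₗ (show X →ₗ[k] S.X₃ from f), LinearMap.ext fun x => hσ _⟩
  · let f' : X →ₗ[k] S.X₂ := f
    have h (x : X) : f' x ∈ LinearMap.range S.f.hom.toLinearMap :=
      hex _ (congrArg (fun φ : X →ₗ[k] S.X₃ => φ x) hf0)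
    refine ⟨(LinearEquiv.ofInjective S.f.hom.toLinearMap hf).symm.toLinearMap ∘ₗ
      LinearMap.codRestrict _ f' h, LinearMap.ext fun x => ?_⟩
    exact congrArg Subtype.val ((LinearEquiv.ofInjective S.f.hom.toLinearMap hf).apply_symm_apply
      ⟨f' x, h x⟩)

/-- The modules `Hom(X, ind A)` have no Tate cohomology. -/
theorem isZero_ihom_ind (X A : Rep.{u} k G) (n : ℤ) :
    Limits.IsZero (tateCohomology ((Rep.ihom X).obj (ind A)) n) := by
  classical
  rw [Limits.IsZero.iff_id_eq_zero]
  rw [← (tateCohomologyFunctor n).map_id ((Rep.ihom X).obj (ind A))]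
  -- The identity of `Hom(X, ind A)` is the norm of composition with `v ↦ (v 1) δ₁`.
  let p : ind A →ₗ[k] ind A := downSection A ∘ₗ LinearMap.proj 1
  have hp (v : G → A) (x g : G) : (ind A).ρ g (p ((ind A).ρ g⁻¹ v)) x = if g = x then v x else 0 := by
    change A.ρ g ((Pi.single 1 (A.ρ g⁻¹ (v (g⁻¹⁻¹ * 1))) : G → A) (g⁻¹ * x)) = _
    rw [Pi.single_apply]
    simp only [inv_mul_eq_one]
    split_ifs with h
    · subst h
      simp
    · simp
  refine tateMap_eq_zero (M := (Rep.ihom X).obj (ind A)) (N := (Rep.ihom X).obj (ind A))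
    (LinearMap.llcomp k X _ _ p) _ (fun f => ?_) n
  refine LinearMap.ext fun y => funext fun x => ?_
  let f' : X →ₗ[k] (G → A) := f
  have h2 (g : G) : (show X →ₗ[k] (G → A) from ((Rep.ihom X).obj (ind A)).ρ g (LinearMap.llcomp k X _ _ p
      (((Rep.ihom X).obj (ind A)).ρ g⁻¹ f))) y =
      (ind A).ρ g (p ((ind A).ρ g⁻¹ (f' y))) := by
    change (ind A).ρ g (p ((ind A).ρ g⁻¹ (f' (X.ρ g⁻¹⁻¹ (X.ρ g⁻¹ y))))) = _
    simp
  refine Eq.trans ?_ (congrFun (LinearMap.sum_apply (R := k) (R₂ := k) (M := X) (M₂ := G → A) _ _ y) x).symm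
  rw [Finset.sum_apply]
  refine Eq.trans ?_ (Finset.sum_congr rfl fun g _ => (congrFun (h2 g) x).symm)
  rw [Finset.sum_congr rfl fun g _ => hp (f' y) x g]
  simp
  rfl

theorem ihom_upSeq_shortExact (X A : Rep.{u} k G) : ((upSeq A).map (Rep.ihom X)).ShortExact :=
  ihom_shortExact X (upSeq_shortExact A) (upSection A) (upSection_spec A)

theorem ihom_downSeq_shortExact (X A : Rep.{u} k G) : ((downSeq A).map (Rep.ihom X)).ShortExact :=
  ihom_shortExact X (downSeq_shortExact A) (downSection A) (downSection_spec A)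

/-- The connecting isomorphism `Ĥⁿ(G, Hom(X, Σ A)) ≅ Ĥⁿ⁺¹(G, Hom(X, A))`. -/
def homUp (X A : Rep.{u} k G) (n m : ℤ) (h : n + 1 = m) :
    tateCohomology ((Rep.ihom X).obj (sigma A)) n ≃+ tateCohomology ((Rep.ihom X).obj A) m :=
  delta (S := (upSeq A).map (Rep.ihom X))
    (ihom_upSeq_shortExact X A) (isZero_ihom_ind X A) n m h

/-- The connecting isomorphism `Ĥⁿ(G, Hom(X, A)) ≅ Ĥⁿ⁺¹(G, Hom(X, Ω A))`. -/
def homDown (X A : Rep.{u} k G) (n m : ℤ) (h : n + 1 = m) :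
    tateCohomology ((Rep.ihom X).obj A) n ≃+ tateCohomology ((Rep.ihom X).obj (omega A)) m :=
  delta (S := (downSeq A).map (Rep.ihom X))
    (ihom_downSeq_shortExact X A) (isZero_ihom_ind X A) n m h

/-- The map induced on `Ĥⁿ(G, Hom(X, -))`. -/
abbrev homMap (X : Rep.{u} k G) {A B : Rep.{u} k G} (f : A ⟶ B) (n : ℤ) :
    tateCohomology ((Rep.ihom X).obj A) n →+ tateCohomology ((Rep.ihom X).obj B) n :=
  tateMap ((Rep.ihom X).map f) n

theorem homUp_naturality (X : Rep.{u} k G) {A B : Rep.{u} k G} (f : A ⟶ B) (n m : ℤ)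
    (h : n + 1 = m) (a : tateCohomology ((Rep.ihom X).obj (sigma A)) n) :
    homMap X f m (homUp X A n m h a) = homUp X B n m h (homMap X (sigmaMap f) n a) :=
  delta_naturality _ _ _ _ ((Rep.ihom X).mapShortComplex.map (upSeqMap f)) n m h a

theorem homDown_naturality (X : Rep.{u} k G) {A B : Rep.{u} k G} (f : A ⟶ B) (n m : ℤ)
    (h : n + 1 = m) (a : tateCohomology ((Rep.ihom X).obj A) n) :
    homMap X (omegaMap f) m (homDown X A n m h a) = homDown X B n m h (homMap X f n a) :=
  delta_naturality _ _ _ _ ((Rep.ihom X).mapShortComplex.map (downSeqMap f)) n m h a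

/-- Up to the canonical map `A ⟶ Σ Ω A`, the connecting isomorphism of `downSeq A` is that of
`upSeq (omega A)`. -/
theorem homDown_eq (X A : Rep.{u} k G) (n m : ℤ) (h : n + 1 = m)
    (a : tateCohomology ((Rep.ihom X).obj A) n) :
    homDown X A n m h a = homUp X (omega A) n m h (homMap X (toSigmaOmega A) n a) := by
  refine Eq.trans ?_
    (delta_naturality (ihom_downSeq_shortExact X A) (isZero_ihom_ind X A)
      (ihom_upSeq_shortExact X _) (isZero_ihom_ind X _) ((Rep.ihom X).mapShortComplex.map (downSeqToUpSeq A)) n m h a)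
  exact ((congrArg (fun f => tateMap f m (homDown X A n m h a))
    ((Rep.ihom X).map_id (omega A))).trans (tateMap_id _ _ _)).symm

/-- Up to the canonical map `Ω Σ A ⟶ A`, the connecting isomorphism of `upSeq A` is that of
`downSeq (sigma A)`. -/
theorem homUp_eq (X A : Rep.{u} k G) (n m : ℤ) (h : n + 1 = m)
    (a : tateCohomology ((Rep.ihom X).obj (sigma A)) n) :
    homUp X A n m h a = homMap X (ofOmegaSigma A) m (homDown X (sigma A) n m h a) := by
  refine Eq.trans ?_
    (delta_naturality (ihom_downSeq_shortExact X _) (isZero_ihom_ind X _)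
      (ihom_upSeq_shortExact X A) (isZero_ihom_ind X A) ((Rep.ihom X).mapShortComplex.map (downSeqSigmaToUpSeq A)) n m h a).symm
  exact congrArg (homUp X A n m h) ((congrArg (fun f => tateMap f n a)
    ((Rep.ihom X).map_id (sigma A))).trans (tateMap_id _ _ _)).symm

/-! ### Naturality of the cup product in the first variable -/

theorem sigmaMap_mkQ {A B : Rep.{u} k G} (f : A ⟶ B) (v : ind A) :
    (sigmaMap f).hom ((upSeq A).g.hom v) = (upSeq B).g.hom ((indMap f).hom v) :=
  congrArg (fun φ : (upSeq A).X₂ ⟶ (upSeq B).X₃ => φ.hom v) (upSeqMap f).comm₂₃.symm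

theorem omegaMap_val {A B : Rep.{u} k G} (f : A ⟶ B) (v : omega A) :
    ((omegaMap f).hom v).1 = (indMap f).hom v.1 :=
  congrArg (fun φ : (downSeq A).X₁ ⟶ (downSeq B).X₂ => φ.hom v) (downSeqMap f).comm₁₂

/-- Morphisms out of `Σ A ⊗ B` are determined on the elements `[v] ⊗ b`. -/
theorem sigma_tensor_ext {A B C : Rep.{u} k G} {f f' : sigma A ⊗ B ⟶ C}
    (h : ∀ (v : ind A) (b : B), f.hom ((upSeq A).g.hom v ⊗ₜ[k] b) =
      f'.hom ((upSeq A).g.hom v ⊗ₜ[k] b)) : f = f' := by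
  refine Rep.hom_ext (Representation.IntertwiningMap.ext (TensorProduct.ext' fun s b => ?_))
  obtain ⟨v, rfl⟩ := Submodule.mkQ_surjective _ s
  exact h v b

theorem tensor_ext {A B C : Rep.{u} k G} {f f' : A ⊗ B ⟶ C}
    (h : ∀ (a : A) (b : B), f.hom (a ⊗ₜ[k] b) = f'.hom (a ⊗ₜ[k] b)) : f = f' :=
  Rep.hom_ext (Representation.IntertwiningMap.ext (TensorProduct.ext' fun s b => h s b))

theorem sigmaTensor_naturality {A A' : Rep.{u} k G} (f : A ⟶ A') (B : Rep.{u} k G) :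
    sigmaMap f ▷ B ≫ sigmaTensor A' B = sigmaTensor A B ≫ sigmaMap (f ▷ B) := by
  refine sigma_tensor_ext fun v b => ?_
  refine (congrArg (fun y => (sigmaTensor A' B).hom (y ⊗ₜ[k] b)) (sigmaMap_mkQ f v)).trans ?_
  exact (sigmaMap_mkQ (f ▷ B) ((indTensor A B).hom (v ⊗ₜ[k] b))).symm

theorem omegaTensor_naturality {A A' : Rep.{u} k G} (f : A ⟶ A') (B : Rep.{u} k G) :
    omegaMap f ▷ B ≫ omegaTensor A' B = omegaTensor A B ≫ omegaMap (f ▷ B) := by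
  refine tensor_ext fun v b => Subtype.ext ?_
  refine Eq.trans ?_ (omegaMap_val (f ▷ B) ((omegaTensor A B).hom (v ⊗ₜ[k] b))).symm
  exact congrArg (fun y => (indTensor A' B).hom (y ⊗ₜ[k] b)) (omegaMap_val f v)

theorem deltaUp_naturality {A B : Rep.{u} k G} (f : A ⟶ B) (n m : ℤ) (h : n + 1 = m)
    (a : tateCohomology (sigma A) n) :
    tateMap f m (deltaUp A n m h a) = deltaUp B n m h (tateMap (sigmaMap f) n a) :=
  delta_naturality (upSeq_shortExact A) (isZero_ind A) (upSeq_shortExact B) (isZero_ind B)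
    (upSeqMap f) n m h a

theorem deltaDown_naturality {A B : Rep.{u} k G} (f : A ⟶ B) (n m : ℤ) (h : n + 1 = m)
    (a : tateCohomology A n) :
    tateMap (omegaMap f) m (deltaDown A n m h a) = deltaDown B n m h (tateMap f n a) :=
  delta_naturality (downSeq_shortExact A) (isZero_ind A) (downSeq_shortExact B) (isZero_ind B)
    (downSeqMap f) n m h a

theorem tateMap_degCast {A B : Rep.{u} k G} (f : A ⟶ B) {m n : ℤ} (h : m = n)
    (a : tateCohomology A m) : tateMap f n (degCast A h a) = degCast B h (tateMap f m a) := by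
  subst h; rfl

/-- The class of a Tate cocycle. -/
def tateClass (A : Rep.{u} k G) (n : ℤ) (z : (tateComplex A).cycles n) : tateCohomology A n :=
  ((tateComplex A).homologyπ n).hom z

theorem tateMap_tateClass {A B : Rep.{u} k G} (f : A ⟶ B) (n : ℤ) (z : (tateComplex A).cycles n) :
    tateMap f n (tateClass A n z) =
      tateClass B n ((HomologicalComplex.cyclesMap (tateComplex.map f) n).hom z) :=
  congrArg (fun φ => φ.hom z)
    (HomologicalComplex.homologyπ_naturality (tateComplex.map f) n)

theorem cocycleValue_naturality {A B : Rep.{u} k G} (f : A ⟶ B) (z : (tateComplex A).cycles 0) :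
    (cocycleValue B ((HomologicalComplex.cyclesMap (tateComplex.map f) 0).hom z) : B) =
      f.hom (cocycleValue A z : A) :=
  congrFun (congrArg (fun φ => φ.hom z)
    (HomologicalComplex.cyclesMap_i (tateComplex.map f) 0)) (default : Fin 0 → G)

theorem tateClass_surjective (A : Rep.{u} k G) (n : ℤ) : Function.Surjective (tateClass A n) :=
  (ModuleCat.epi_iff_surjective ((tateComplex A).homologyπ n)).1 inferInstance

theorem cupZero_tateClass (A B : Rep.{u} k G) (q : ℤ) (z : (tateComplex A).cycles 0)
    (b : tateCohomology B q) :
    cupZero A B q (tateClass A 0 z) b =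
      tateMap (tmulLeft A B (cocycleValue A z)) q b :=
  DFunLike.congr_fun (AddMonoidHom.liftOfRightInverse_comp_apply _ _ _ _ z) b

theorem cupZero_naturality {A A' : Rep.{u} k G} (f : A ⟶ A') (B : Rep.{u} k G) (q : ℤ)
    (a : tateCohomology A 0) (b : tateCohomology B q) :
    cupZero A' B q (tateMap f 0 a) b = tateMap (f ▷ B) q (cupZero A B q a b) := by
  obtain ⟨z, rfl⟩ := tateClass_surjective A 0 a
  rw [tateMap_tateClass, cupZero_tateClass, cupZero_tateClass, ← tateMap_comp]
  congr 2
  refine Rep.hom_ext (Representation.IntertwiningMap.ext (LinearMap.ext fun b => ?_))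
  exact congrArg (fun y => y ⊗ₜ[k] b) (cocycleValue_naturality f z)

theorem cupNonneg_succ (p : ℕ) (A B : Rep.{u} k G) (q n : ℤ) (h : ((p + 1 : ℕ) : ℤ) + q = n)
    (h' : (p : ℤ) + q = n - 1)
    (a : tateCohomology (sigma A) p) (b : tateCohomology B q) :
    cupNonneg (p + 1) A B q n h (deltaUp A p (p + 1 : ℕ) (by simp) a) b =
      deltaUp (A ⊗ B) (n - 1) n (by lia)
        (tateMap (sigmaTensor A B) (n - 1) (cupNonneg p (sigma A) B q (n - 1) h' a b)) := by
  conv_rhs => rw [← (deltaUp A p (p + 1 : ℕ) (by simp)).symm_apply_apply a]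
  rfl

theorem cupNonpos_succ (p : ℕ) (A B : Rep.{u} k G) (q n : ℤ) (h : -((p + 1 : ℕ) : ℤ) + q = n)
    (h' : -(p : ℤ) + q = n + 1)
    (a : tateCohomology A (-((p + 1 : ℕ) : ℤ))) (b : tateCohomology B q) :
    deltaDown (A ⊗ B) n (n + 1) rfl (cupNonpos (p + 1) A B q n h a b) =
      tateMap (omegaTensor A B) (n + 1) (cupNonpos p (omega A) B q (n + 1) h'
        (deltaDown A (-((p + 1 : ℕ) : ℤ)) (-(p : ℤ)) (by push_cast; lia) a) b) :=
  (deltaDown (A ⊗ B) n (n + 1) rfl).apply_symm_apply _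

theorem cupNonneg_naturality (p : ℕ) {A A' : Rep.{u} k G} (f : A ⟶ A') (B : Rep.{u} k G)
    (q n : ℤ) (h : (p : ℤ) + q = n) (a : tateCohomology A p) (b : tateCohomology B q) :
    cupNonneg p A' B q n h (tateMap f p a) b = tateMap (f ▷ B) n (cupNonneg p A B q n h a b) := by
  induction p generalizing A A' n with
  | zero =>
    refine Eq.trans ?_ (tateMap_degCast (f ▷ B) _ _).symm
    exact congrArg _ (cupZero_naturality f B q a b)
  | succ p ih =>
    have h' : (p : ℤ) + q = n - 1 := by push_cast at h; lia
    obtain ⟨a, rfl⟩ := (deltaUp A p (p + 1 : ℕ) (by simp)).surjective a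
    rw [deltaUp_naturality, cupNonneg_succ _ _ _ _ _ _ h', cupNonneg_succ _ _ _ _ _ _ h',
      deltaUp_naturality, ih, tateMap_comm (sigmaTensor_naturality f B)]

theorem cupNonpos_naturality (p : ℕ) {A A' : Rep.{u} k G} (f : A ⟶ A') (B : Rep.{u} k G)
    (q n : ℤ) (h : -(p : ℤ) + q = n) (a : tateCohomology A (-(p : ℤ))) (b : tateCohomology B q) :
    cupNonpos p A' B q n h (tateMap f _ a) b = tateMap (f ▷ B) n (cupNonpos p A B q n h a b) := by
  induction p generalizing A A' n with
  | zero => exact cupNonneg_naturality 0 f B q n (by simpa using h) a b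
  | succ p ih =>
    have h' : -(p : ℤ) + q = n + 1 := by push_cast at h; lia
    apply (deltaDown (A' ⊗ B) n (n + 1) rfl).injective
    rw [← deltaDown_naturality, cupNonpos_succ _ _ _ _ _ _ h', cupNonpos_succ _ _ _ _ _ _ h',
      ← deltaDown_naturality, ih, tateMap_comm (omegaTensor_naturality f B)]

theorem cup_naturality {A A' : Rep.{u} k G} (f : A ⟶ A') (B : Rep.{u} k G) (p q n : ℤ)
    (h : p + q = n) (a : tateCohomology A p) (b : tateCohomology B q) :
    cup A' B p q n h (tateMap f p a) b = tateMap (f ▷ B) n (cup A B p q n h a b) := by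
  obtain p | p := p
  · exact cupNonneg_naturality p f B q n h a b
  · exact cupNonpos_naturality (p + 1) f B q n h a b

theorem homCup_naturality (X X' : Rep.{u} k G) {A A' : Rep.{u} k G} (f : A ⟶ A') (s r n : ℤ)
    (h : s + r = n) (a : tateCohomology ((Rep.ihom X).obj A) s)
    (x : tateCohomology ((Rep.ihom X').obj X) r) :
    homCup X X' A' s r n h (homMap X f s a) x = homMap X' f n (homCup X X' A s r n h a x) := by
  refine (congrArg (tateMap (homComp X X' A') n) (cup_naturality _ _ s r n h a x)).trans ?_
  have e : (Rep.ihom X).map f ▷ (Rep.ihom X').obj X ≫ homComp X X' A' =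
      homComp X X' A ≫ (Rep.ihom X').map f := tensor_ext fun _ _ => rfl
  exact tateMap_comm e _ _

/-! ### The modules `Hom(X, -)` and the dimension-shifting sequences -/

/-- The canonical map `ind Hom(X, A) ⟶ Hom(X, ind A)`. -/
def indIhom (X A : Rep.{u} k G) : ind ((Rep.ihom X).obj A) ⟶ (Rep.ihom X).obj (ind A) :=
  Rep.ofHom (ρ := (ind ((Rep.ihom X).obj A)).ρ) (σ := Representation.linHom X.ρ (ind A).ρ)
    ⟨{ toFun v := LinearMap.pi fun x => (show X →ₗ[k] A from v x)
       map_add' _ _ := rfl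
       map_smul' _ _ := rfl }, fun _ => rfl⟩

/-- The canonical morphism from the sequence `upSeq Hom(X, A)` to `Hom(X, upSeq A)`. -/
def upIhom (X A : Rep.{u} k G) : upSeq ((Rep.ihom X).obj A) ⟶ (upSeq A).map (Rep.ihom X) :=
  homOfLeft (upSeq_shortExact _) (𝟙 _) (indIhom X A) rfl

/-- The canonical morphism from the sequence `downSeq Hom(X, A)` to `Hom(X, downSeq A)`. -/
def downIhom (X A : Rep.{u} k G) : downSeq ((Rep.ihom X).obj A) ⟶ (downSeq A).map (Rep.ihom X) :=
  homOfRight (ihom_downSeq_shortExact X A) (indIhom X A) (𝟙 _) (by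
    refine Rep.hom_ext (Representation.IntertwiningMap.ext (LinearMap.ext fun v =>
      LinearMap.ext fun y => ?_))
    refine (indSum_apply A _).trans ?_
    refine Eq.trans ?_ (congrArg (fun φ : X →ₗ[k] A => φ y) (indSum_apply _ v)).symm
    exact (LinearMap.sum_apply (R := k) (R₂ := k) (M := X) (M₂ := A) _ _ y).symm)

/-- The canonical map `Σ Hom(X, A) ⟶ Hom(X, Σ A)`. -/
def sigmaIhom (X A : Rep.{u} k G) : sigma ((Rep.ihom X).obj A) ⟶ (Rep.ihom X).obj (sigma A) :=
  (upIhom X A).τ₃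

/-- The canonical map `Ω Hom(X, A) ⟶ Hom(X, Ω A)`. -/
def omegaIhom (X A : Rep.{u} k G) : omega ((Rep.ihom X).obj A) ⟶ (Rep.ihom X).obj (omega A) :=
  (downIhom X A).τ₁

theorem homUp_sigmaIhom (X A : Rep.{u} k G) (n m : ℤ) (h : n + 1 = m)
    (a : tateCohomology (sigma ((Rep.ihom X).obj A)) n) :
    homUp X A n m h (tateMap (sigmaIhom X A) n a) = deltaUp _ n m h a :=
  (delta_naturality (upSeq_shortExact _) (isZero_ind _) (ihom_upSeq_shortExact X A)
    (isZero_ihom_ind X A) (upIhom X A) n m h a).symm.trans (tateMap_id _ _ _)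

theorem homDown_omegaIhom (X A : Rep.{u} k G) (n m : ℤ) (h : n + 1 = m)
    (a : tateCohomology ((Rep.ihom X).obj A) n) :
    tateMap (omegaIhom X A) m (deltaDown _ n m h a) = homDown X A n m h a :=
  (delta_naturality (downSeq_shortExact _) (isZero_ind _) (ihom_downSeq_shortExact X A)
    (isZero_ihom_ind X A) (downIhom X A) n m h a).trans (congrArg _ (tateMap_id _ _ _))

/-- Composition of homomorphisms is compatible with `Σ`; this is what carries the recursive rule for
the cup product over to `homCup`. -/
theorem sigmaTensor_homComp (X X' A : Rep.{u} k G) :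
    sigmaTensor ((Rep.ihom X).obj A) ((Rep.ihom X').obj X) ≫ sigmaMap (homComp X X' A) ≫
        (sigmaIhom X' A) =
      (sigmaIhom X A) ▷ (Rep.ihom X').obj X ≫ homComp X X' (sigma A) := by
  refine sigma_tensor_ext fun v φ => ?_
  have h (Y : Rep.{u} k G) (w : ind ((Rep.ihom Y).obj A)) :
      (sigmaIhom Y A).hom ((upSeq _).g.hom w) =
        ((Rep.ihom Y).map (upSeq A).g).hom ((indIhom Y A).hom w) :=
    congrArg (fun ψ : (upSeq _).X₂ ⟶ ((upSeq A).map (Rep.ihom Y)).X₃ => ψ.hom w)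
      (upIhom Y A).comm₂₃.symm
  refine Eq.trans ?_ (congrArg (fun y => (homComp X X' (sigma A)).hom (y ⊗ₜ[k] φ)) (h X v)).symm
  refine (congrArg (sigmaIhom X' A).hom (sigmaMap_mkQ (homComp X X' A)
    ((indTensor _ _).hom (v ⊗ₜ[k] φ)))).trans ?_
  exact h X' _

/-- The counterpart of `sigmaTensor_homComp` for `Ω`. -/
theorem omegaTensor_homComp (X X' A : Rep.{u} k G) :
    omegaTensor ((Rep.ihom X).obj A) ((Rep.ihom X').obj X) ≫ omegaMap (homComp X X' A) ≫
        (omegaIhom X' A) =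
      (omegaIhom X A) ▷ (Rep.ihom X').obj X ≫ homComp X X' (omega A) := by
  refine tensor_ext fun v φ => LinearMap.ext fun y => Subtype.ext ?_
  have h (Y : Rep.{u} k G) (w : omega ((Rep.ihom Y).obj A)) :
      ((Rep.ihom Y).map (downSeq A).f).hom ((omegaIhom Y A).hom w) = (indIhom Y A).hom w.1 :=
    congrArg (fun ψ : (downSeq _).X₁ ⟶ ((downSeq A).map (Rep.ihom Y)).X₂ => ψ.hom w)
      (downIhom Y A).comm₁₂
  have h1 := congrArg (fun ψ : X' →ₗ[k] ind A => ψ y) (h X' ((omegaMap (homComp X X' A)).hom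
    ((omegaTensor _ _).hom (v ⊗ₜ[k] φ))))
  have h2 := congrArg (fun ψ : X →ₗ[k] ind A => ψ ((show X' →ₗ[k] X from φ) y)) (h X v)
  refine h1.trans (Eq.trans ?_ h2.symm)
  exact congrArg (fun w => (show X' →ₗ[k] ind A from (indIhom X' A).hom w) y)
    (omegaMap_val (homComp X X' A) ((omegaTensor _ _).hom (v ⊗ₜ[k] φ)))

/-! ### Products and connecting isomorphisms -/

theorem sigmaIhom_surjective (X A : Rep.{u} k G) (n : ℤ)
    (a : tateCohomology ((Rep.ihom X).obj (sigma A)) n) :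
    ∃ a', tateMap (sigmaIhom X A) n a' = a := by
  refine ⟨(deltaUp _ n (n + 1) rfl).symm (homUp X A n (n + 1) rfl a), ?_⟩
  apply (homUp X A n (n + 1) rfl).injective
  rw [homUp_sigmaIhom, AddEquiv.apply_symm_apply]

theorem cup_deltaUp (A B : Rep.{u} k G) (p : ℕ) (q n m : ℤ) (h : n + 1 = m) (hn : (p : ℤ) + q = n)
    (hm : (p : ℤ) + 1 + q = m) (a : tateCohomology (sigma A) p) (b : tateCohomology B q) :
    cup A B (p + 1) q m hm (deltaUp A p (p + 1) rfl a) b =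
      deltaUp (A ⊗ B) n m h (tateMap (sigmaTensor A B) n (cup (sigma A) B p q n hn a b)) := by
  obtain rfl : n = m - 1 := by lia
  exact cupNonneg_succ p A B q m hm hn a b

theorem cup_deltaDown (A B : Rep.{u} k G) (p : ℕ) (q n m : ℤ) (h : n + 1 = m)
    (hn : Int.negSucc p + q = n) (hm : -(p : ℤ) + q = m)
    (a : tateCohomology A (Int.negSucc p)) (b : tateCohomology B q) :
    deltaDown (A ⊗ B) n m h (cup A B (Int.negSucc p) q n hn a b) =
      tateMap (omegaTensor A B) m (cup (omega A) B (-(p : ℤ)) q m hm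
        (deltaDown A (Int.negSucc p) (-(p : ℤ)) (by lia) a) b) := by
  subst h
  refine (cupNonpos_succ p A B q n hn hm a b).trans ?_
  cases p <;> rfl

/-- The product commutes with the connecting isomorphisms of `0 ⟶ A ⟶ ind A ⟶ Σ A ⟶ 0` in
nonnegative degrees. -/
theorem homCup_homUp_nonneg (X X' A : Rep.{u} k G) (p : ℕ) (r n m : ℤ) (h : n + 1 = m)
    (hn : (p : ℤ) + r = n) (hm : (p : ℤ) + 1 + r = m)
    (a : tateCohomology ((Rep.ihom X).obj (sigma A)) p)
    (x : tateCohomology ((Rep.ihom X').obj X) r) :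
    homCup X X' A (p + 1) r m hm (homUp X A p (p + 1) rfl a) x =
      homUp X' A n m h (homCup X X' (sigma A) p r n hn a x) := by
  obtain ⟨a, rfl⟩ := sigmaIhom_surjective X A p a
  rw [homUp_sigmaIhom]
  refine (congrArg (tateMap (homComp X X' A) m) (cup_deltaUp _ _ p r n m h hn hm a x)).trans ?_
  rw [deltaUp_naturality, ← homUp_sigmaIhom]
  refine congrArg _ ?_
  rw [← tateMap_comp, ← tateMap_comp]
  refine (congrArg (fun f => tateMap f n _) (sigmaTensor_homComp X X' A)).trans ?_
  rw [tateMap_comp, ← cup_naturality]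
  rfl

/-- The product commutes with the connecting isomorphisms of `0 ⟶ Ω A ⟶ ind A ⟶ A ⟶ 0` in
negative degrees. -/
theorem homCup_homDown_neg (X X' A : Rep.{u} k G) (p : ℕ) (r n m : ℤ) (h : n + 1 = m)
    (hn : Int.negSucc p + r = n) (hm : -(p : ℤ) + r = m)
    (a : tateCohomology ((Rep.ihom X).obj A) (Int.negSucc p))
    (x : tateCohomology ((Rep.ihom X').obj X) r) :
    homCup X X' (omega A) (-(p : ℤ)) r m hm (homDown X A (Int.negSucc p) (-(p : ℤ)) (by lia) a) x =
      homDown X' A n m h (homCup X X' A (Int.negSucc p) r n hn a x) := by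
  refine Eq.trans ?_ (homDown_omegaIhom X' A n m h _)
  refine Eq.trans ?_ (congrArg _ (deltaDown_naturality (homComp X X' A) n m h _))
  rw [cup_deltaDown _ _ p r n m h hn hm, ← homDown_omegaIhom, ← tateMap_comp, ← tateMap_comp]
  refine Eq.trans ?_ (congrArg (fun f => tateMap f m _) (omegaTensor_homComp X X' A)).symm
  rw [tateMap_comp, ← cup_naturality]
  rfl

/-- In degrees `s ≥ 0` this follows from the rule for `Σ` by naturality along `A ⟶ Σ Ω A`. -/
theorem homCup_homDown (X X' A : Rep.{u} k G) (s t r n m : ℤ) (hs : s + 1 = t) (h : n + 1 = m)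
    (hn : s + r = n) (hm : t + r = m) (a : tateCohomology ((Rep.ihom X).obj A) s)
    (x : tateCohomology ((Rep.ihom X').obj X) r) :
    homCup X X' (omega A) t r m hm (homDown X A s t hs a) x =
      homDown X' A n m h (homCup X X' A s r n hn a x) := by
  obtain p | p := s
  · subst hs
    rw [homDown_eq, homDown_eq, ← homCup_naturality]
    exact homCup_homUp_nonneg X X' (omega A) p r n m h hn hm _ x
  · obtain rfl : t = -(p : ℤ) := by lia
    exact homCup_homDown_neg X X' A p r n m h hn hm a x

/-- The rule for `Σ` in all degrees, from the one for `Ω` by naturality along `Ω Σ A ⟶ A`. -/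
theorem homCup_homUp (X X' A : Rep.{u} k G) (s t r n m : ℤ) (hs : s + 1 = t) (h : n + 1 = m)
    (hn : s + r = n) (hm : t + r = m) (a : tateCohomology ((Rep.ihom X).obj (sigma A)) s)
    (x : tateCohomology ((Rep.ihom X').obj X) r) :
    homCup X X' A t r m hm (homUp X A s t hs a) x =
      homUp X' A n m h (homCup X X' (sigma A) s r n hn a x) := by
  rw [homUp_eq, homUp_eq, homCup_naturality, homCup_homDown X X' _ s t r n m hs h hn hm]

theorem toSigmaOmega_injective (X A : Rep.{u} k G) (n : ℤ) :
    Function.Injective (homMap X (toSigmaOmega A) n) := fun a b hab => by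
  apply (homDown X A n (n + 1) rfl).injective
  rw [homDown_eq, homDown_eq, hab]

/-! ### Natural families of maps as products -/

/-- Every natural family of maps `Ĥˢ(G, Hom(X, A)) → Ĥⁿ(G, Hom(X', A))`, where `n = s + r`, is
the product with a unique class of degree `r`. -/
def Representable (X X' : Rep.{u} k G) (r s : ℤ) : Prop :=
  ∀ (n : ℤ) (h : s + r = n) (Φ : (A : Rep.{u} k G) → tateCohomology ((Rep.ihom X).obj A) s →
    tateCohomology ((Rep.ihom X').obj A) n),
    (∀ (A B : Rep.{u} k G) (f : A ⟶ B) (a), Φ B (homMap X f s a) = homMap X' f n (Φ A a)) →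
    ∃! x : tateCohomology ((Rep.ihom X').obj X) r, ∀ A a, Φ A a = homCup X X' A s r n h a x

/-- A family `Φ` in degree `s + 1` is shifted to the family `δ⁻¹ Φ_{Ω A} δ` in degree `s`. -/
theorem Representable.succ {X X' : Rep.{u} k G} {r s : ℤ} (H : Representable X X' r s) :
    Representable X X' r (s + 1) := by
  intro m hm Φ hΦ
  have hn : s + r = m - 1 := by lia
  have h1 : m - 1 + 1 = m := by lia
  obtain ⟨x, hx, hu⟩ := H (m - 1) hn
    (fun A a => (homDown X' A (m - 1) m h1).symm (Φ _ (homDown X A s (s + 1) rfl a)))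
    (fun A B f a => by
      rw [AddEquiv.symm_apply_eq, ← homDown_naturality, hΦ, ← homDown_naturality,
        AddEquiv.apply_symm_apply])
  refine ⟨x, fun A a => ?_, fun y hy => hu y fun A a => ?_⟩
  · obtain ⟨a, rfl⟩ := (homUp X A s (s + 1) rfl).surjective a
    -- `Φ` is known on the modules `Ω B` only; every class comes from `Ω Σ A` along `Ω Σ A ⟶ A`.
    rw [homUp_eq, hΦ, homCup_naturality, homCup_homDown X X' _ s (s + 1) r (m - 1) m rfl h1 hn hm,
      ← hx, AddEquiv.apply_symm_apply]
  · rw [AddEquiv.symm_apply_eq, hy, homCup_homDown X X' _ s (s + 1) r (m - 1) m rfl h1 hn hm]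

/-- A family `Φ` in degree `s` is shifted to the family `δ Φ_{Σ A} δ⁻¹` in degree `s + 1`. -/
theorem Representable.pred {X X' : Rep.{u} k G} {r s t : ℤ} (hs : s + 1 = t)
    (H : Representable X X' r t) : Representable X X' r s := by
  intro n hn Φ hΦ
  have hm : t + r = n + 1 := by lia
  obtain ⟨x, hx, hu⟩ := H (n + 1) hm
    (fun A a => homUp X' A n (n + 1) rfl (Φ _ ((homUp X A s t hs).symm a)))
    (fun A B f a => by
      rw [homUp_naturality, ← hΦ]
      congr 2
      rw [AddEquiv.symm_apply_eq, ← homUp_naturality, AddEquiv.apply_symm_apply])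
  have key (A : Rep.{u} k G) (a) : Φ (sigma A) a = homCup X X' (sigma A) s r n hn a x := by
    have := hx A (homUp X A s t hs a)
    rw [AddEquiv.symm_apply_apply, homCup_homUp X X' _ s t r n (n + 1) hs rfl hn hm] at this
    exact (homUp X' A n (n + 1) rfl).injective this
  refine ⟨x, fun A a => ?_, fun y hy => hu y fun A a => ?_⟩
  -- `Φ` is known on the modules `Σ B` only; `A ⟶ Σ Ω A` is injective on cohomology.
  · apply toSigmaOmega_injective X' A n
    rw [← hΦ, key, homCup_naturality]
  · rw [hy, ← homCup_homUp X X' _ s t r n (n + 1) hs rfl hn hm, AddEquiv.apply_symm_apply]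

/-- The `G`-morphism `X ⟶ A` given by a `G`-invariant linear map. -/
def homOfInvariant {X A : Rep.{u} k G} (f : ((Rep.ihom X).obj A).ρ.invariants) : X ⟶ A :=
  Rep.ofHom ⟨(show X →ₗ[k] A from f.1), fun g => by
    refine LinearMap.ext fun y => ?_
    have h := congrArg (fun φ : X →ₗ[k] A => φ (X.ρ g y)) (f.2 g)
    refine h.symm.trans (congrArg (fun y => A.ρ g ((show X →ₗ[k] A from f.1) y)) ?_)
    exact X.ρ.inv_self_apply g y⟩

/-! ### Degree zero -/

theorem cocycleValue_injective (A : Rep.{u} k G) : Function.Injective (cocycleValue A) := by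
  intro z z' h
  apply (ModuleCat.mono_iff_injective ((tateComplex A).iCycles 0)).1 inferInstance
  refine funext fun t => ?_
  rw [Subsingleton.elim t default]
  exact congrArg Subtype.val h

theorem cocycleValue_surjective (A : Rep.{u} k G) : Function.Surjective (cocycleValue A) := by
  intro a
  have hex := ShortComplex.exact_of_f_is_kernel
    (ShortComplex.mk _ _ ((tateComplex A).iCycles_d 0 1))
    ((tateComplex A).cyclesIsKernel 0 1 (by simp))
  rw [ShortComplex.moduleCat_exact_iff] at hex
  obtain ⟨z, hz⟩ := hex (fun _ : Fin 0 → G => (a.1 : A)) (by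
    change ((groupCohomology.inhomogeneousCochains A).d 0 1).hom _ = 0
    rw [groupCohomology.inhomogeneousCochains.d_def]
    refine funext fun t => (inhomogeneousCochains.d_hom_apply A 0 _ t).trans ?_
    simp [a.2 (t 0)]
    rfl)
  exact ⟨z, Subtype.ext (congrFun hz default)⟩

/-- The product with the class of an invariant `f` in degree zero is induced by `f`. -/
theorem homCup_zero (X X' A : Rep.{u} k G) (r n : ℤ) (h : 0 + r = n)
    (z : (tateComplex ((Rep.ihom X).obj A)).cycles 0) (x : tateCohomology ((Rep.ihom X').obj X) r) :
    homCup X X' A 0 r n h (tateClass _ 0 z) x =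
      degCast _ ((zero_add r).symm.trans h) (homMap X' (homOfInvariant (cocycleValue _ z)) r x) := by
  have e : tmulLeft ((Rep.ihom X).obj A) ((Rep.ihom X').obj X) (cocycleValue _ z) ≫
      homComp X X' A = (Rep.ihom X').map (homOfInvariant (cocycleValue _ z)) := rfl
  refine (tateMap_degCast _ _ _).trans (congrArg _ ?_)
  rw [cupZero_tateClass, ← tateMap_comp]
  exact congrArg (fun f => tateMap f r x) e

/-- A degree-zero class of `Hom(X, A)` is the image of the class of `id_X` under a morphism `X ⟶ A`,
so that a natural family is determined by its value on that class, as in the Yoneda lemma. -/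
theorem representable_zero (X X' : Rep.{u} k G) (r : ℤ) : Representable X X' r 0 := by
  intro n hn Φ hΦ
  obtain ⟨z₁, hz₁⟩ := cocycleValue_surjective ((Rep.ihom X).obj X)
    ⟨(LinearMap.id : X →ₗ[k] X), fun g => LinearMap.ext fun y => X.ρ.self_inv_apply g y⟩
  have hone : homOfInvariant (cocycleValue _ z₁) = 𝟙 X := by rw [hz₁]; rfl
  have hcup (x) : homCup X X' X 0 r n hn (tateClass _ 0 z₁) x =
      degCast _ ((zero_add r).symm.trans hn) x := by
    rw [homCup_zero, hone, homMap, (Rep.ihom X').map_id, tateMap_id]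
  refine ⟨(degCast _ ((zero_add r).symm.trans hn)).symm
    (Φ X (tateClass _ 0 z₁)), fun A a => ?_, fun y hy => ?_⟩
  · obtain ⟨z, rfl⟩ := tateClass_surjective _ 0 a
    have hz : tateClass _ 0 z = homMap X (homOfInvariant (cocycleValue _ z)) 0
        (tateClass _ 0 z₁) := by
      rw [tateMap_tateClass]
      refine congrArg _ (cocycleValue_injective _ (Subtype.ext ?_))
      rw [cocycleValue_naturality, hz₁]
      rfl
    rw [homCup_zero, ← tateMap_degCast, AddEquiv.apply_symm_apply, ← hΦ, ← hz]
  · rw [hy X, hcup, AddEquiv.symm_apply_apply]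

theorem representable (X X' : Rep.{u} k G) (r s : ℤ) : Representable X X' r s := by
  induction s using Int.induction_on with
  | zero => exact representable_zero X X' r
  | succ s ih => exact ih.succ
  | pred s ih => exact ih.pred (by lia)

end TateCup

end


theorem proposition2p8 {G : Type} [Group G] [Fintype G] (X X' : Rep.{0} ℤ G) (r s : ℤ)
    (Φ : Rep.ihom X ⋙ tateCohomologyFunctor s ⟶ Rep.ihom X' ⋙ tateCohomologyFunctor (r + s)) :
    ∃! x : tateCohomology ((Rep.ihom X').obj X) r,
      ∀ (A : Rep.{0} ℤ G) (a : tateCohomology ((Rep.ihom X).obj A) s),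
        Φ.app A a = TateCup.homCup X X' A s r (r + s) (add_comm s r) a x :=
  TateCup.representable X X' r s (r + s) (add_comm s r) (fun A a => Φ.app A a)
    fun _ _ f a => congrArg (fun φ => φ.hom a) (Φ.naturality f)
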